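/- Let $(X,\rho)$ be a compact metric space and $T\colon X\to X$ a homeomorphism. For $T$-invariant Borel probability measures $\mu,\nu$ on $X$ put $$\bar\rho(\mu,\nu)=\inf_{\lambda}\int_{X\times X}\rho(x,y)\,d\lambda(x,y),$$ where $\lambda$ ranges over the joinings of $\mu$ and $\nu$, that is, over the $T\times T$-invariant Borel probability measures on $X\times X$ whose marginals on the first and second coordinate are $\mu$ and $\nu$. Let $\mathrm{Spec}(X,T,\mu)$ be the set of eigenvalues of the Koopman operator $U_T f=f\circ T$ on the complex space $L^2(X,\mu)$. The measure $\mu$ has discrete spectrum if the linear span of the eigenfunctions of $U_T$ is dense in $L^2(X,\mu)$, and it is weakly mixing if $\lim_{N\to\infty}\frac1N\sum_{n=0}^{N-1}|\mu(T^{-n}A\cap B)-\mu(A)\mu(B)|=0$ for all Borel sets $A,B\subseteq X$. Let $(\mu_k)_{k\ge1}$ be ergodic $T$-invariant Borel probability measures on $X$ and let $\mu$ be an ergodic $T$-invariant Borel probability measure on $X$ with $\bar\rho(\mu_k,\mu)\to0$ as $k\to\infty$. Then $$\mathrm{Spec}(X,T,\mu)\subseteq\bigcup_{K=1}^\infty\bigcap_{k=K}^\infty\mathrm{Spec}(X,T,\mu_k).$$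 Furthermore, if $\mu_k$ has discrete spectrum for every $k\ge1$, then $\mu$ has discrete spectrum; and if $\mu_k$ is weakly mixing for every $k\ge1$, then $\mu$ is weakly mixing. -/

import Mathlib

open MeasureTheory Filter Topology

namespace RhoBar

/-- A joining of `μ` and `ν`: a `T × S`-invariant measure with marginals `μ` and `ν`. -/
structure IsJoining {X Y : Type*} [MeasurableSpace X] [MeasurableSpace Y]
    (T : X → X) (S : Y → Y) (μ : Measure X) (ν : Measure Y) (lam : Measure (X × Y)) : Prop where
  invariant : MeasurePreserving (Prod.map T S) lam lam
  map_fst : lam.map Prod.fst = μ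
  map_snd : lam.map Prod.snd = ν

/-- The distance `ρ̄(μ, ν)`: the infimum, over all joinings `λ` of `μ` and `ν`, of the integral
of `ρ` against `λ`, where `ρ` is the metric of `X`. -/
noncomputable def rhoBar {X : Type*} [MetricSpace X] [MeasurableSpace X]
    (T : X → X) (μ ν : Measure X) : ℝ :=
  sInf {r : ℝ | ∃ lam : Measure (X × X), IsJoining T T μ ν lam ∧ r = ∫ p, dist p.1 p.2 ∂lam}

section Spectral

variable {X : Type*} [MeasurableSpace X] {T : X → X} {μ : Measure X}

/-- The Koopman operator `f ↦ f ∘ T` on the complex Hilbert space `L²(X, μ)`. -/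
noncomputable def koopman (hT : MeasurePreserving T μ μ) : Lp ℂ 2 μ →ₗ[ℂ] Lp ℂ 2 μ :=
  Lp.compMeasurePreservingₗ ℂ T hT

/-- `Spec(X, T, μ)`: the set of eigenvalues of the Koopman operator. -/
def spec (hT : MeasurePreserving T μ μ) : Set ℂ :=
  {ξ : ℂ | Module.End.HasEigenvalue (koopman hT) ξ}

/-- Discrete spectrum: the eigenfunctions of the Koopman operator span a dense subspace. -/
def HasDiscreteSpectrum (hT : MeasurePreserving T μ μ) : Prop :=
  Dense (Submodule.span ℂ
    {f : Lp ℂ 2 μ | ∃ ξ : ℂ, Module.End.HasEigenvector (koopman hT) ξ f} : Set (Lp ℂ 2 μ))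

end Spectral

/-- Weak mixing of a probability measure `μ` that `T` preserves: for all measurable `A`, `B` the
Cesàro means of `|μ(T⁻ⁿ A ∩ B) - μ(A) μ(B)|` tend to `0`. -/
def IsWeaklyMixing {X : Type*} [MeasurableSpace X] (T : X → X) (μ : Measure X) : Prop :=
  ∀ A B : Set X, MeasurableSet A → MeasurableSet B →
    Tendsto (fun N : ℕ => (1 / (N : ℝ)) *
        ∑ n ∈ Finset.range N, |μ.real ((T^[n]) ⁻¹' A ∩ B) - μ.real A * μ.real B|)
      atTop (𝓝 0)

end RhoBar

/-! A joining `lam` embeds both L²(μ_k) and L²(μ) isometrically in L²(`lam`), intertwining the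
Koopman operators. When the integral of the distance is small, a continuous function read in either
coordinate gives nearly the same vector; hence each fixed vector of L²(μ) lies near the image of
L²(μ_k) for large k (`exists_norm_lift_sub_le`).

Embedding one L² and applying the adjoint of the other embedding sends eigenvectors to eigenvectors
or to 0 (`adjoint_eigenvector`), and 0 is excluded for a vector near the image
(`norm_le_of_adjoint_eq_zero`). This transfers eigenvalues from μ to μ_k. If μ_k has discrete
spectrum, a vector orthogonal to all eigenvectors of μ is sent to 0, so it must vanish. For weak
mixing, correlations of μ are approximated, uniformly in time, by correlations of a single μ_k. -/

namespace RhoBar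

/-! ### Cesàro null sequences -/

/-- The Cesàro means of the norms of the sequence `c` tend to `0`. -/
def CesaroNull (c : ℕ → ℂ) : Prop :=
  Tendsto (fun N : ℕ => (1 / (N : ℝ)) * ∑ n ∈ Finset.range N, ‖c n‖) atTop (𝓝 0)

theorem cesaroMean_nonneg (c : ℕ → ℂ) (N : ℕ) :
    0 ≤ (1 / (N : ℝ)) * ∑ n ∈ Finset.range N, ‖c n‖ := by positivity

theorem CesaroNull.add {c d : ℕ → ℂ} (hc : CesaroNull c) (hd : CesaroNull d) :
    CesaroNull (fun n => c n + d n) := by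
  have h := Tendsto.add hc hd
  rw [add_zero] at h
  refine squeeze_zero (cesaroMean_nonneg _) (fun N => ?_) h
  rw [← mul_add, ← Finset.sum_add_distrib]
  gcongr
  exact norm_add_le _ _

theorem CesaroNull.const_mul {c : ℕ → ℂ} (hc : CesaroNull c) (z : ℂ) :
    CesaroNull (fun n => z * c n) := by
  have h := Tendsto.const_mul ‖z‖ hc
  rw [mul_zero] at h
  refine h.congr fun N => ?_
  simp only [norm_mul, ← Finset.mul_sum]
  ring

/-- A uniform limit of Cesàro null sequences is Cesàro null. -/
theorem CesaroNull.of_forall_approx {c : ℕ → ℂ}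
    (h : ∀ ε > 0, ∃ d, CesaroNull d ∧ ∀ n, ‖c n - d n‖ ≤ ε) : CesaroNull c := by
  refine Metric.tendsto_atTop.2 fun ε hε => ?_
  obtain ⟨d, hd, hcd⟩ := h (ε / 2) (by positivity)
  obtain ⟨M, hM⟩ := Metric.tendsto_atTop.1 hd (ε / 2) (by positivity)
  refine ⟨M, fun N hN => ?_⟩
  have hdN := hM N hN
  rw [Real.dist_0_eq_abs, abs_of_nonneg (cesaroMean_nonneg _ _)] at hdN ⊢
  have h1 : ∑ n ∈ Finset.range N, ‖c n‖ ≤ N * (ε / 2) + ∑ n ∈ Finset.range N, ‖d n‖ := by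
    calc ∑ n ∈ Finset.range N, ‖c n‖ ≤ ∑ n ∈ Finset.range N, (ε / 2 + ‖d n‖) := by
          gcongr with n
          have := norm_sub_norm_le (c n) (d n)
          linarith [hcd n]
      _ = _ := by simp [Finset.sum_add_distrib]
  have h2 : (1 / (N : ℝ)) * (N * (ε / 2)) ≤ ε / 2 := by
    rcases Nat.eq_zero_or_pos N with rfl | hN
    · rw [Nat.cast_zero, zero_mul, mul_zero]; positivity
    · field_simp; rfl
  calc (1 / (N : ℝ)) * ∑ n ∈ Finset.range N, ‖c n‖
      ≤ (1 / (N : ℝ)) * (N * (ε / 2) + ∑ n ∈ Finset.range N, ‖d n‖) := by gcongr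
    _ < ε := by rw [mul_add]; linarith

/-! ### Isometries of Hilbert spaces: correlations and intertwining embeddings -/

section Hilbert

variable {H K : Type*} [NormedAddCommGroup H] [InnerProductSpace ℂ H]
  [NormedAddCommGroup K] [InnerProductSpace ℂ K]

/-- The correlation sequence of the vectors `a`, `b` relative to the vector `e`. -/
noncomputable def corr (U : H →ₗ[ℂ] H) (e a b : H) (n : ℕ) : ℂ :=
  inner ℂ b ((U ^ n) a) - inner ℂ b e * inner ℂ e a

theorem corr_add_left (U : H →ₗ[ℂ] H) (e a a' b : H) (n : ℕ) :
    corr U e (a + a') b n = corr U e a b n + corr U e a' b n := by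
  simp only [corr, map_add, inner_add_right]; ring

theorem corr_smul_left (U : H →ₗ[ℂ] H) (e a b : H) (z : ℂ) (n : ℕ) :
    corr U e (z • a) b n = z * corr U e a b n := by
  simp only [corr, map_smul, inner_smul_right]; ring

theorem corr_add_right (U : H →ₗ[ℂ] H) (e a b b' : H) (n : ℕ) :
    corr U e a (b + b') n = corr U e a b n + corr U e a b' n := by
  simp only [corr, inner_add_left]; ring

theorem corr_smul_right (U : H →ₗ[ℂ] H) (e a b : H) (z : ℂ) (n : ℕ) :
    corr U e a (z • b) n = starRingEnd ℂ z * corr U e a b n := by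
  simp only [corr, inner_smul_left]; ring

theorem norm_pow_apply {U : H →ₗ[ℂ] H} (hU : ∀ x, ‖U x‖ = ‖x‖) (n : ℕ) (x : H) :
    ‖(U ^ n) x‖ = ‖x‖ := by
  induction n with
  | zero => simp
  | succ n ih => rw [pow_succ', Module.End.mul_apply, hU, ih]

theorem norm_corr_le {U : H →ₗ[ℂ] H} (hU : ∀ x, ‖U x‖ = ‖x‖) {e : H} (he : ‖e‖ = 1)
    (a b : H) (n : ℕ) : ‖corr U e a b n‖ ≤ 2 * ‖a‖ * ‖b‖ := by
  have h1 : ‖inner ℂ b ((U ^ n) a)‖ ≤ ‖b‖ * ‖a‖ := by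
    simpa only [norm_pow_apply hU] using norm_inner_le_norm (𝕜 := ℂ) b ((U ^ n) a)
  have h2 : ‖inner ℂ b e * inner ℂ e a‖ ≤ ‖b‖ * ‖a‖ := by
    rw [norm_mul]
    have hb := norm_inner_le_norm (𝕜 := ℂ) b e
    have ha := norm_inner_le_norm (𝕜 := ℂ) e a
    rw [he, mul_one] at hb
    rw [he, one_mul] at ha
    gcongr
  calc ‖corr U e a b n‖ ≤ _ := norm_sub_le _ _
    _ ≤ 2 * ‖a‖ * ‖b‖ := by linarith

/-- Correlations are sesquilinear, so one entry is changed at a time. The bound does not depend on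
`n`, as `CesaroNull.of_forall_approx` requires. -/
theorem norm_corr_sub_corr_le {U : H →ₗ[ℂ] H} (hU : ∀ x, ‖U x‖ = ‖x‖) {e : H} (he : ‖e‖ = 1)
    (a b a' b' : H) (n : ℕ) :
    ‖corr U e a b n - corr U e a' b' n‖ ≤ 2 * ‖a - a'‖ * ‖b‖ + 2 * ‖a'‖ * ‖b - b'‖ := by
  have h1 := corr_add_left U e (a - a') a' b n
  have h2 := corr_add_right U e a' (b - b') b' n
  rw [sub_add_cancel] at h1 h2
  have : corr U e a b n - corr U e a' b' n = corr U e (a - a') b n + corr U e a' (b - b') n := by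
    rw [h1, h2]; ring
  rw [this]
  exact (norm_add_le _ _).trans (add_le_add (norm_corr_le hU he _ _ _) (norm_corr_le hU he _ _ _))

theorem isClosed_cesaroNull_corr_left {U : H →ₗ[ℂ] H} (hU : ∀ x, ‖U x‖ = ‖x‖) {e : H}
    (he : ‖e‖ = 1) (b : H) : IsClosed {a | CesaroNull (corr U e a b)} := by
  refine isClosed_of_closure_subset fun a ha => CesaroNull.of_forall_approx fun ε hε => ?_
  obtain ⟨a', ha', haa'⟩ := Metric.mem_closure_iff.1 ha (ε / (2 * (‖b‖ + 1))) (by positivity)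
  refine ⟨_, ha', fun n => (norm_corr_sub_corr_le hU he a b a' b n).trans ?_⟩
  rw [dist_eq_norm, lt_div_iff₀ (by positivity)] at haa'
  rw [sub_self, norm_zero]
  nlinarith [norm_nonneg (a - a')]

theorem isClosed_cesaroNull_corr_right {U : H →ₗ[ℂ] H} (hU : ∀ x, ‖U x‖ = ‖x‖) {e : H}
    (he : ‖e‖ = 1) (a : H) : IsClosed {b | CesaroNull (corr U e a b)} := by
  refine isClosed_of_closure_subset fun b hb => CesaroNull.of_forall_approx fun ε hε => ?_
  obtain ⟨b', hb', hbb'⟩ := Metric.mem_closure_iff.1 hb (ε / (2 * (‖a‖ + 1))) (by positivity)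
  refine ⟨_, hb', fun n => (norm_corr_sub_corr_le hU he a b a b' n).trans ?_⟩
  rw [dist_eq_norm, lt_div_iff₀ (by positivity)] at hbb'
  rw [sub_self, norm_zero]
  nlinarith [norm_nonneg (b - b')]

theorem pow_apply_of_semiconj {U : H →ₗ[ℂ] H} {W : K →ₗ[ℂ] K} (J : H →ₗᵢ[ℂ] K)
    (hJ : ∀ x, W (J x) = J (U x)) (n : ℕ) (x : H) : (W ^ n) (J x) = J ((U ^ n) x) := by
  induction n with
  | zero => simp
  | succ n ih => rw [pow_succ', pow_succ', Module.End.mul_apply, Module.End.mul_apply, ih, hJ]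

theorem corr_map {U : H →ₗ[ℂ] H} {W : K →ₗ[ℂ] K} (J : H →ₗᵢ[ℂ] K)
    (hJ : ∀ x, W (J x) = J (U x)) (e a b : H) (n : ℕ) :
    corr W (J e) (J a) (J b) n = corr U e a b n := by
  simp only [corr, pow_apply_of_semiconj J hJ, J.inner_map_map]

theorem norm_eigenvalue_eq_one {W : K →ₗ[ℂ] K} (hW : ∀ x, ‖W x‖ = ‖x‖) {g : K} {ξ : ℂ}
    (hg : W g = ξ • g) (hg0 : g ≠ 0) : ‖ξ‖ = 1 := by
  have h := hW g
  rw [hg, norm_smul] at h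
  exact mul_right_cancel₀ (norm_ne_zero_iff.2 hg0) (h.trans (one_mul _).symm)

/-- The adjoint of an embedding that intertwines two isometries maps eigenvectors to
eigenvectors. -/
theorem adjoint_eigenvector [CompleteSpace H] [CompleteSpace K]
    {U : H →ₗ[ℂ] H} {W : K →ₗ[ℂ] K} (hU : ∀ x, ‖U x‖ = ‖x‖) (hW : ∀ x, ‖W x‖ = ‖x‖)
    (J : H →ₗᵢ[ℂ] K) (hJ : ∀ x, W (J x) = J (U x)) {g : K} {ξ : ℂ} (hg : W g = ξ • g) :
    U (J.toContinuousLinearMap.adjoint g) = ξ • J.toContinuousLinearMap.adjoint g := by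
  rcases eq_or_ne g 0 with rfl | hg0
  · simp
  have hξ := norm_eigenvalue_eq_one hW hg hg0
  set a := J.toContinuousLinearMap.adjoint g with ha
  have key (x : H) : inner ℂ x a = inner ℂ (J x) g := by
    rw [ha, ContinuousLinearMap.adjoint_inner_right]; rfl
  have hWi : ∀ x y, inner ℂ (W x) (W y) = inner ℂ x y :=
    (⟨W, hW⟩ : K →ₗᵢ[ℂ] K).inner_map_map
  -- Moving ξ • g = W g through `J` turns the left side into ⟨W J a, W g⟩ = ⟨J a, g⟩. With |ξ| = 1
  -- this is the equality case of Cauchy–Schwarz for U a and ξ • a.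
  have h1 : inner ℂ (U a) (ξ • a) = inner ℂ a a := by
    rw [inner_smul_right, key, ← hJ, ← inner_smul_right, ← hg, hWi, ← key]
  have h2 : ‖U a - ξ • a‖ ^ 2 = 0 := by
    rw [norm_sub_sq (𝕜 := ℂ), h1, hU, norm_smul, hξ, one_mul, inner_self_eq_norm_sq]
    ring
  exact sub_eq_zero.1 (norm_eq_zero.1 (pow_eq_zero_iff two_ne_zero |>.1 h2))

/-- A vector that is close to the range of `J` is not annihilated by the adjoint of `J`. -/
theorem norm_le_of_adjoint_eq_zero [CompleteSpace H] [CompleteSpace K] (J : H →ₗᵢ[ℂ] K) {g : K}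
    (hg : J.toContinuousLinearMap.adjoint g = 0) (x : H) : ‖g‖ ≤ ‖g - J x‖ := by
  have h0 : inner ℂ g (J x) = 0 := by
    have := ContinuousLinearMap.adjoint_inner_left J.toContinuousLinearMap x g
    rw [hg, inner_zero_left] at this
    exact this.symm
  -- Pythagoras: g is orthogonal to J x.
  have h := norm_sub_sq (𝕜 := ℂ) g (J x)
  rw [h0, map_zero] at h
  nlinarith [norm_nonneg g, norm_nonneg (g - J x), sq_nonneg ‖J x‖]

end Hilbert

/-! ### Koopman operators and weak mixing in terms of L² correlations -/

section Koopman

variable {X : Type*} [MeasurableSpace X] {T : X → X} {μ : Measure X}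

theorem norm_koopman (hT : MeasurePreserving T μ μ) (f : Lp ℂ 2 μ) : ‖koopman hT f‖ = ‖f‖ :=
  Lp.norm_compMeasurePreserving f hT

/-- Pulling back along a factor map intertwines the Koopman operators. -/
theorem koopman_compMeasurePreserving {Y : Type*} [MeasurableSpace Y] {S : Y → Y} {ν : Measure Y}
    (hT : MeasurePreserving T μ μ) (hS : MeasurePreserving S ν ν) {p : X → Y}
    (hp : MeasurePreserving p μ ν) (h : p ∘ T = S ∘ p) (f : Lp ℂ 2 ν) :
    koopman hT (Lp.compMeasurePreservingₗᵢ ℂ p hp f) =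
      Lp.compMeasurePreservingₗᵢ ℂ p hp (koopman hS f) := by
  have h1 := Lp.compMeasurePreserving_comp_apply f hp hT
  have h2 := Lp.compMeasurePreserving_comp_apply f hS hp
  refine h1.symm.trans (Eq.trans ?_ h2)
  congr 2

theorem koopman_pow_apply (hT : MeasurePreserving T μ μ) (n : ℕ) (f : Lp ℂ 2 μ) :
    (koopman hT ^ n) f = Lp.compMeasurePreserving T^[n] (hT.iterate n) f := by
  rw [Module.End.pow_apply, ← Lp.compMeasurePreserving_iterate]
  rfl

/-- The constant function `1` in `L²`. -/
noncomputable def one (μ : Measure X) [IsFiniteMeasure μ] : Lp ℂ 2 μ :=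
  indicatorConstLp 2 MeasurableSet.univ (measure_ne_top μ _) 1

theorem norm_one (μ : Measure X) [IsProbabilityMeasure μ] : ‖one μ‖ = 1 := by
  rw [one, norm_indicatorConstLp two_ne_zero ENNReal.ofNat_ne_top]
  simp

theorem compMeasurePreserving_one {Y : Type*} [MeasurableSpace Y] {ν : Measure Y}
    [IsFiniteMeasure μ] [IsFiniteMeasure ν] {p : X → Y} (hp : MeasurePreserving p μ ν) :
    Lp.compMeasurePreservingₗᵢ ℂ p hp (one ν) = one μ :=
  Lp.indicatorConstLp_compMeasurePreserving MeasurableSet.univ _ (1 : ℂ) hp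

theorem corr_indicator [IsFiniteMeasure μ] (hT : MeasurePreserving T μ μ) {A B : Set X}
    (hA : MeasurableSet A) (hB : MeasurableSet B) (n : ℕ) :
    corr (koopman hT) (one μ) (indicatorConstLp 2 hA (measure_ne_top μ _) 1)
      (indicatorConstLp 2 hB (measure_ne_top μ _) 1) n =
      ((μ.real (T^[n] ⁻¹' A ∩ B) - μ.real A * μ.real B : ℝ) : ℂ) := by
  rw [corr, koopman_pow_apply, Lp.indicatorConstLp_compMeasurePreserving, one,
    L2.inner_indicatorConstLp_one_indicatorConstLp_one (𝕜 := ℂ) hB,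
    L2.inner_indicatorConstLp_one_indicatorConstLp_one (𝕜 := ℂ) hB,
    L2.inner_indicatorConstLp_one_indicatorConstLp_one (𝕜 := ℂ) MeasurableSet.univ]
  simp [Set.inter_comm, mul_comm]

theorem isWeaklyMixing_iff_indicator [IsFiniteMeasure μ] (hT : MeasurePreserving T μ μ) :
    IsWeaklyMixing T μ ↔ ∀ (A B : Set X) (hA : MeasurableSet A) (hB : MeasurableSet B),
      CesaroNull (corr (koopman hT) (one μ) (indicatorConstLp 2 hA (measure_ne_top μ _) 1)
        (indicatorConstLp 2 hB (measure_ne_top μ _) 1)) := by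
  simp only [IsWeaklyMixing, CesaroNull, corr_indicator, Complex.norm_real, Real.norm_eq_abs]

/-- A property of vectors of `L²` that is closed under sums, scalars and limits holds for all
vectors if it holds for indicator functions. -/
theorem Lp_induction_indicator [IsFiniteMeasure μ] {P : Lp ℂ 2 μ → Prop}
    (hind : ∀ (A : Set X) (hA : MeasurableSet A),
      P (indicatorConstLp 2 hA (measure_ne_top μ _) 1))
    (hsmul : ∀ (z : ℂ) f, P f → P (z • f)) (hadd : ∀ f g, P f → P g → P (f + g))
    (hclosed : IsClosed {f | P f}) (f : Lp ℂ 2 μ) : P f := by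
  refine Lp.induction ENNReal.ofNat_ne_top P (fun c A hA hμA => ?_)
    (fun f g hf hg _ => hadd _ _) hclosed f
  have : indicatorConstLp 2 hA hμA.ne c = c • (indicatorConstLp 2 hA hμA.ne (1 : ℂ) : Lp ℂ 2 μ) :=
    ((MemLp.toLp_const_smul c (memLp_indicator_const 2 hA (1 : ℂ) (.inr hμA.ne))).symm.trans
      (MemLp.toLp_congr _ _ (.of_forall fun x => by
        by_cases hx : x ∈ A <;> simp [hx]))).symm
  rw [Lp.simpleFunc.coe_indicatorConst, this]
  exact hsmul _ _ (hind A hA)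

/-- Extends from indicators to all vectors one variable at a time. Arbitrary vectors are needed
because the approximants found along a joining are not indicators. -/
theorem isWeaklyMixing_iff [IsProbabilityMeasure μ] (hT : MeasurePreserving T μ μ) :
    IsWeaklyMixing T μ ↔ ∀ f g, CesaroNull (corr (koopman hT) (one μ) f g) := by
  rw [isWeaklyMixing_iff_indicator hT]
  refine ⟨fun h f g => ?_, fun h A B _ _ => h _ _⟩
  have hU := norm_koopman hT
  refine Lp_induction_indicator (fun B hB => ?_) (fun z g hg => ?_) (fun g g' hg hg' => ?_)
    (isClosed_cesaroNull_corr_right hU (norm_one μ) f) g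
  · refine Lp_induction_indicator (fun A hA => h A B hA hB) (fun z f hf => ?_)
      (fun f f' hf hf' => ?_) (isClosed_cesaroNull_corr_left hU (norm_one μ) _) f
    · simpa only [← corr_smul_left] using hf.const_mul z
    · simpa only [← corr_add_left] using hf.add hf'
  · simpa only [← corr_smul_right] using hg.const_mul (starRingEnd ℂ z)
  · simpa only [← corr_add_right] using hg.add hg'

end Koopman

/-! ### Joinings and transfer of eigenvectors -/

section Joining

variable {X Y : Type*} [MeasurableSpace X] [MeasurableSpace Y] {T : X → X} {S : Y → Y}
  {μ : Measure X} {ν : Measure Y} {lam : Measure (X × Y)}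

theorem IsJoining.measurePreserving_fst (h : IsJoining T S μ ν lam) :
    MeasurePreserving Prod.fst lam μ := ⟨measurable_fst, h.map_fst⟩

theorem IsJoining.measurePreserving_snd (h : IsJoining T S μ ν lam) :
    MeasurePreserving Prod.snd lam ν := ⟨measurable_snd, h.map_snd⟩

theorem IsJoining.isProbabilityMeasure [IsProbabilityMeasure μ] (h : IsJoining T S μ ν lam) :
    IsProbabilityMeasure lam :=
  ⟨(h.measurePreserving_fst.measure_preimage MeasurableSet.univ.nullMeasurableSet).trans
    measure_univ⟩

/-- The embedding of `L²` of the first marginal into `L²` of a joining. -/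
noncomputable def IsJoining.liftFst (h : IsJoining T S μ ν lam) : Lp ℂ 2 μ →ₗᵢ[ℂ] Lp ℂ 2 lam :=
  Lp.compMeasurePreservingₗᵢ ℂ Prod.fst h.measurePreserving_fst

/-- The embedding of `L²` of the second marginal into `L²` of a joining. -/
noncomputable def IsJoining.liftSnd (h : IsJoining T S μ ν lam) : Lp ℂ 2 ν →ₗᵢ[ℂ] Lp ℂ 2 lam :=
  Lp.compMeasurePreservingₗᵢ ℂ Prod.snd h.measurePreserving_snd

theorem IsJoining.koopman_liftFst (h : IsJoining T S μ ν lam) (hT : MeasurePreserving T μ μ)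
    (f : Lp ℂ 2 μ) : koopman h.invariant (h.liftFst f) = h.liftFst (koopman hT f) :=
  koopman_compMeasurePreserving h.invariant hT h.measurePreserving_fst rfl f

theorem IsJoining.koopman_liftSnd (h : IsJoining T S μ ν lam) (hS : MeasurePreserving S ν ν)
    (f : Lp ℂ 2 ν) : koopman h.invariant (h.liftSnd f) = h.liftSnd (koopman hS f) :=
  koopman_compMeasurePreserving h.invariant hS h.measurePreserving_snd rfl f

/-- The composite is the Markov operator L²(ν) → L²(μ) attached to the joining. The image may be 0,
so only the eigenvalue equation is claimed. -/
theorem IsJoining.koopman_adjoint_liftFst (h : IsJoining T S μ ν lam)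
    (hT : MeasurePreserving T μ μ) (hS : MeasurePreserving S ν ν) {f : Lp ℂ 2 ν} {ξ : ℂ}
    (hf : koopman hS f = ξ • f) :
    koopman hT (h.liftFst.toContinuousLinearMap.adjoint (h.liftSnd f)) =
      ξ • h.liftFst.toContinuousLinearMap.adjoint (h.liftSnd f) :=
  adjoint_eigenvector (norm_koopman hT) (norm_koopman h.invariant) h.liftFst
    (h.koopman_liftFst hT) (by rw [h.koopman_liftSnd hS, hf, map_smul])

theorem IsJoining.koopman_adjoint_liftSnd (h : IsJoining T S μ ν lam)
    (hT : MeasurePreserving T μ μ) (hS : MeasurePreserving S ν ν) {f : Lp ℂ 2 μ} {ξ : ℂ}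
    (hf : koopman hT f = ξ • f) :
    koopman hS (h.liftSnd.toContinuousLinearMap.adjoint (h.liftFst f)) =
      ξ • h.liftSnd.toContinuousLinearMap.adjoint (h.liftFst f) :=
  adjoint_eigenvector (norm_koopman hS) (norm_koopman h.invariant) h.liftSnd
    (h.koopman_liftSnd hS) (by rw [h.koopman_liftFst hT, hf, map_smul])

theorem isJoining_prod [IsProbabilityMeasure μ] [IsProbabilityMeasure ν]
    (hT : MeasurePreserving T μ μ) (hS : MeasurePreserving S ν ν) :
    IsJoining T S μ ν (μ.prod ν) :=
  ⟨hT.prod hS, by simp, by simp⟩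

/-- If an eigenvector of `S` lifts into the closure of the lift of `L²(μ)`, its eigenvalue is an
eigenvalue of `T`. -/
theorem IsJoining.mem_spec (h : IsJoining T S μ ν lam)
    (hT : MeasurePreserving T μ μ) (hS : MeasurePreserving S ν ν) {f : Lp ℂ 2 ν} {ξ : ℂ}
    (hf : koopman hS f = ξ • f) {a : Lp ℂ 2 μ} (ha : ‖h.liftSnd f - h.liftFst a‖ < ‖f‖) :
    ξ ∈ spec hT := by
  refine Module.End.hasEigenvalue_of_hasEigenvector
    (x := h.liftFst.toContinuousLinearMap.adjoint (h.liftSnd f))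
    ⟨Module.End.mem_eigenspace_iff.2 (h.koopman_adjoint_liftFst hT hS hf), fun h0 => ?_⟩
  have := norm_le_of_adjoint_eq_zero h.liftFst h0 a
  rw [LinearIsometry.norm_map] at this
  exact this.not_gt ha

/-- If `T` has discrete spectrum, a vector orthogonal to all eigenvectors of `S` lifts to a vector
orthogonal to the lift of `L²(μ)`. -/
theorem IsJoining.adjoint_liftFst_eq_zero (h : IsJoining T S μ ν lam)
    (hT : MeasurePreserving T μ μ) (hS : MeasurePreserving S ν ν)
    (hdisc : HasDiscreteSpectrum hT) {g : Lp ℂ 2 ν}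
    (hg : ∀ (ξ : ℂ) (f : Lp ℂ 2 ν), koopman hS f = ξ • f → inner ℂ f g = 0) :
    h.liftFst.toContinuousLinearMap.adjoint (h.liftSnd g) = 0 := by
  set a := h.liftFst.toContinuousLinearMap.adjoint (h.liftSnd g) with ha
  refine hdisc.eq_zero_of_inner_right ℂ fun v hv => ?_
  induction hv using Submodule.span_induction with
  | mem v hv =>
    obtain ⟨ξ, hξ⟩ := hv
    -- The image of v in L²(ν) satisfies the eigenvalue equation but may vanish; `hg` is therefore
    -- stated for all solutions, zero included. Two adjoint moves then turn ⟨v, a⟩ into a product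
    -- covered by `hg`.
    have hv' := h.koopman_adjoint_liftSnd hT hS (Module.End.mem_eigenspace_iff.1 hξ.1)
    rw [ha, ContinuousLinearMap.adjoint_inner_right, ← hg ξ _ hv',
      ContinuousLinearMap.adjoint_inner_left]
    rfl
  | zero => exact inner_zero_left _
  | add v w _ _ hv hw => rw [inner_add_left, hv, hw, add_zero]
  | smul z v _ hv => rw [inner_smul_left, hv, mul_zero]

end Joining

/-! ### Joinings concentrated near the diagonal -/

section Metric

variable {X : Type*} [MetricSpace X] [CompactSpace X] [MeasurableSpace X] [BorelSpace X]
  {T : X → X} {μ ν : Measure X}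

theorem integrable_dist (lam : Measure (X × X)) [IsFiniteMeasure lam] :
    Integrable (fun p : X × X => dist p.1 p.2) lam :=
  (continuous_dist.integrable_of_hasCompactSupport (HasCompactSupport.of_compactSpace _))

-- The product joining makes the set nonempty; the infimum of an empty set would default to 0 and
-- yield no joining.
omit [CompactSpace X] [BorelSpace X] in
theorem exists_isJoining_of_rhoBar_lt [IsProbabilityMeasure μ] [IsProbabilityMeasure ν]
    (hT : MeasurePreserving T μ μ) (hS : MeasurePreserving T ν ν) {δ : ℝ}
    (h : rhoBar T μ ν < δ) :
    ∃ lam, IsJoining T T μ ν lam ∧ ∫ p, dist p.1 p.2 ∂lam < δ := by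
  obtain ⟨r, ⟨lam, hlam, rfl⟩, hr⟩ := exists_lt_of_csInf_lt
    (s := {r : ℝ | ∃ lam : Measure (X × X), IsJoining T T μ ν lam ∧ r = ∫ p, dist p.1 p.2 ∂lam})
    ⟨_, _, isJoining_prod hT hS, rfl⟩ h
  exact ⟨lam, hlam, hr⟩

omit [MeasurableSpace X] [BorelSpace X] in
/-- The squared oscillation of a continuous function is dominated by a multiple of the distance up
to a small constant. -/
theorem exists_sq_dist_le (f : C(X, ℂ)) {ε : ℝ} (hε : 0 < ε) :
    ∃ C > 0, ∀ x y, ‖f y - f x‖ ^ 2 ≤ ε + C * dist x y := by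
  obtain ⟨δ, hδ, h⟩ := Metric.uniformContinuous_iff.1
    (CompactSpace.uniformContinuous_of_continuous f.continuous) (√ε) (by positivity)
  -- For points at distance at least δ, dist / δ ≥ 1 absorbs the crude bound on the oscillation. The
  -- summand 1 keeps C positive even if f = 0.
  refine ⟨(2 * ‖f‖ + 1) ^ 2 / δ, by positivity, fun x y => ?_⟩
  rcases lt_or_ge (dist x y) δ with hxy | hxy
  · have h1 := h hxy
    rw [dist_comm, dist_eq_norm] at h1
    have h2 : ‖f y - f x‖ ^ 2 ≤ √ε ^ 2 := by gcongr
    rw [Real.sq_sqrt hε.le] at h2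
    have : 0 ≤ (2 * ‖f‖ + 1) ^ 2 / δ * dist x y := by positivity
    linarith
  · have h1 : ‖f y - f x‖ ≤ 2 * ‖f‖ + 1 := by
      linarith [norm_sub_le (f y) (f x), f.norm_coe_le_norm x, f.norm_coe_le_norm y]
    have h2 : ‖f y - f x‖ ^ 2 ≤ (2 * ‖f‖ + 1) ^ 2 := by gcongr
    have h3 : (2 * ‖f‖ + 1) ^ 2 ≤ (2 * ‖f‖ + 1) ^ 2 / δ * dist x y := by
      rw [div_mul_eq_mul_div, le_div_iff₀ hδ]
      gcongr
    linarith

theorem IsJoining.norm_lift_toLp_sub_sq [IsProbabilityMeasure μ] [IsProbabilityMeasure ν]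
    {lam : Measure (X × X)} (h : IsJoining T T μ ν lam) (f : C(X, ℂ)) :
    ‖h.liftSnd (ContinuousMap.toLp 2 ν ℂ f) - h.liftFst (ContinuousMap.toLp 2 μ ℂ f)‖ ^ 2 =
      ∫ p, ‖f p.2 - f p.1‖ ^ 2 ∂lam := by
  rw [← inner_self_eq_norm_sq (𝕜 := ℂ), L2.inner_def, ← integral_re]
  · refine integral_congr_ae ?_
    have e₁ : h.liftFst (ContinuousMap.toLp 2 μ ℂ f) =ᵐ[lam] fun p => f p.1 :=
      (Lp.coeFn_compMeasurePreserving _ h.measurePreserving_fst).trans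
        (h.measurePreserving_fst.quasiMeasurePreserving.ae_eq_comp
          (ContinuousMap.coeFn_toLp (p := 2) (𝕜 := ℂ) μ f))
    have e₂ : h.liftSnd (ContinuousMap.toLp 2 ν ℂ f) =ᵐ[lam] fun p => f p.2 :=
      (Lp.coeFn_compMeasurePreserving _ h.measurePreserving_snd).trans
        (h.measurePreserving_snd.quasiMeasurePreserving.ae_eq_comp
          (ContinuousMap.coeFn_toLp (p := 2) (𝕜 := ℂ) ν f))
    filter_upwards [e₁, e₂, Lp.coeFn_sub (h.liftSnd (ContinuousMap.toLp 2 ν ℂ f))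
      (h.liftFst (ContinuousMap.toLp 2 μ ℂ f))] with p h₁ h₂ h₃
    rw [h₃, Pi.sub_apply, h₁, h₂, inner_self_eq_norm_sq]
  · exact L2.integrable_inner _ _

/-- Every vector of `L²(ν)` is close to a vector of `L²(μ)` along any joining that is sufficiently
concentrated near the diagonal. -/
theorem exists_norm_lift_sub_le [IsProbabilityMeasure ν] (a : Lp ℂ 2 ν) {ε : ℝ} (hε : 0 < ε) :
    ∃ δ > 0, ∀ (μ : Measure X) [IsProbabilityMeasure μ] (lam : Measure (X × X))
      (h : IsJoining T T μ ν lam), ∫ p, dist p.1 p.2 ∂lam < δ →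
      ∃ b : Lp ℂ 2 μ, ‖h.liftSnd a - h.liftFst b‖ ≤ ε := by
  obtain ⟨f, hf⟩ := (ContinuousMap.toLp_denseRange ℂ ν ℂ (p := 2)
    ENNReal.ofNat_ne_top).exists_dist_lt a (half_pos hε)
  obtain ⟨C, hC, hfC⟩ := exists_sq_dist_le f (ε := (ε / 2) ^ 2 / 2) (by positivity)
  -- This δ makes C times the integral at most (ε / 2)² / 2, the other half being the constant term.
  -- It depends only on `f`, whose class in L²(μ) is the required vector for every μ.
  refine ⟨(ε / 2) ^ 2 / 2 / C, by positivity, fun μ _ lam h hlam => ?_⟩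
  refine ⟨ContinuousMap.toLp 2 μ ℂ f, ?_⟩
  have := h.isProbabilityMeasure
  have hi := integrable_dist lam
  have h1 : ‖h.liftSnd (ContinuousMap.toLp 2 ν ℂ f) -
      h.liftFst (ContinuousMap.toLp 2 μ ℂ f)‖ ^ 2 ≤ (ε / 2) ^ 2 := by
    rw [h.norm_lift_toLp_sub_sq f]
    calc ∫ p, ‖f p.2 - f p.1‖ ^ 2 ∂lam
        ≤ ∫ p, ((ε / 2) ^ 2 / 2 + C * dist p.1 p.2) ∂lam :=
          integral_mono_of_nonneg (.of_forall fun p => by positivity)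
            ((integrable_const _).add (hi.const_mul C)) (.of_forall fun p => hfC p.1 p.2)
      _ = (ε / 2) ^ 2 / 2 + C * ∫ p, dist p.1 p.2 ∂lam := by
          rw [integral_add (integrable_const _) (hi.const_mul C), integral_const_mul]
          simp
      _ ≤ (ε / 2) ^ 2 := by
          rw [lt_div_iff₀ hC] at hlam
          linarith
  have h2 := abs_le_of_sq_le_sq h1 (by positivity)
  rw [abs_of_nonneg (norm_nonneg _)] at h2
  rw [dist_eq_norm] at hf
  calc ‖h.liftSnd a - h.liftFst (ContinuousMap.toLp 2 μ ℂ f)‖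
      = ‖h.liftSnd (a - ContinuousMap.toLp 2 ν ℂ f) + (h.liftSnd (ContinuousMap.toLp 2 ν ℂ f) -
          h.liftFst (ContinuousMap.toLp 2 μ ℂ f))‖ := by rw [map_sub]; abel_nf
    _ ≤ ‖a - ContinuousMap.toLp 2 ν ℂ f‖ + ε / 2 := by
        refine (norm_add_le _ _).trans ?_
        rw [LinearIsometry.norm_map]
        gcongr
    _ ≤ ε := by linarith

end Metric

end RhoBar

/-! ### The three conclusions -/

theorem mainTheorem2 {X : Type*} [MetricSpace X] [CompactSpace X]
    [MeasurableSpace X] [BorelSpace X] (T : X ≃ₜ X)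
    (μ : ℕ → Measure X) (μ' : Measure X)
    [∀ k, IsProbabilityMeasure (μ k)] [IsProbabilityMeasure μ']
    (hμ : ∀ k, Ergodic T (μ k)) (hμ' : Ergodic T μ')
    (hlim : Tendsto (fun k => RhoBar.rhoBar T (μ k) μ') atTop (𝓝 0)) :
    RhoBar.spec hμ'.toMeasurePreserving ⊆
        ⋃ K : ℕ, ⋂ k : ℕ, ⋂ _ : K ≤ k, RhoBar.spec (hμ k).toMeasurePreserving ∧
      ((∀ k, RhoBar.HasDiscreteSpectrum (hμ k).toMeasurePreserving) →
        RhoBar.HasDiscreteSpectrum hμ'.toMeasurePreserving) ∧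
      ((∀ k, RhoBar.IsWeaklyMixing T (μ k)) → RhoBar.IsWeaklyMixing T μ') := by
  have hclose (δ : ℝ) (hδ : 0 < δ) : ∀ᶠ k in atTop, ∃ lam,
      RhoBar.IsJoining T T (μ k) μ' lam ∧ ∫ p, dist p.1 p.2 ∂lam < δ := by
    filter_upwards [hlim.eventually_lt_const hδ] with k hk
    exact RhoBar.exists_isJoining_of_rhoBar_lt (hμ k).toMeasurePreserving
      hμ'.toMeasurePreserving hk
  refine ⟨fun ξ hξ => ?_, fun hdisc => ?_, fun hmix => ?_⟩
  · obtain ⟨f, hf, hf0⟩ := hξ.exists_hasEigenvector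
    rw [Module.End.mem_eigenspace_iff] at hf
    obtain ⟨δ, hδ, h⟩ := RhoBar.exists_norm_lift_sub_le (T := T) f
      (half_pos (norm_pos_iff.2 hf0))
    obtain ⟨K, hK⟩ := eventually_atTop.1 (hclose δ hδ)
    refine Set.mem_iUnion.2 ⟨K, Set.mem_iInter₂.2 fun k hk => ?_⟩
    obtain ⟨lam, hlam, hd⟩ := hK k hk
    obtain ⟨b, hb⟩ := h (μ k) lam hlam hd
    exact hlam.mem_spec _ hμ'.toMeasurePreserving hf
      (hb.trans_lt (half_lt_self (norm_pos_iff.2 hf0)))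
  · refine Submodule.dense_iff_topologicalClosure_eq_top.2
      ((Submodule.topologicalClosure_eq_top_iff).2 ((Submodule.eq_bot_iff _).2 fun g hg => ?_))
    by_contra hg0
    obtain ⟨δ, hδ, h⟩ := RhoBar.exists_norm_lift_sub_le (T := T) g
      (half_pos (norm_pos_iff.2 hg0))
    obtain ⟨k, lam, hlam, hd⟩ := (hclose δ hδ).exists
    obtain ⟨b, hb⟩ := h (μ k) lam hlam hd
    have h0 := hlam.adjoint_liftFst_eq_zero _ hμ'.toMeasurePreserving (hdisc k) (g := g)
      fun ξ f hf => by
        rcases eq_or_ne f 0 with rfl | hf0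
        · exact inner_zero_left _
        · exact hg f (Submodule.subset_span ⟨ξ, Module.End.mem_eigenspace_iff.2 hf, hf0⟩)
    have := RhoBar.norm_le_of_adjoint_eq_zero hlam.liftFst h0 b
    rw [LinearIsometry.norm_map] at this
    linarith [norm_pos_iff.2 hg0]
  · have hT' := hμ'.toMeasurePreserving
    refine (RhoBar.isWeaklyMixing_iff hT').2 fun f g => .of_forall_approx fun ε hε => ?_
    -- The product is the final correlation error; η ≤ 1 gives ‖a‖ ≤ ‖f‖ + 1.
    obtain ⟨η, hη, hη1, hηε⟩ : ∃ η > 0, η ≤ 1 ∧ η * (2 * ‖g‖ + 2 * (‖f‖ + 1)) ≤ ε :=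
      ⟨min 1 (ε / (2 * ‖g‖ + 2 * (‖f‖ + 1))), by positivity, min_le_left _ _,
        (le_div_iff₀ (by positivity)).1 (min_le_right _ _)⟩
    obtain ⟨δ₁, hδ₁, h₁⟩ := RhoBar.exists_norm_lift_sub_le (T := T) f hη
    obtain ⟨δ₂, hδ₂, h₂⟩ := RhoBar.exists_norm_lift_sub_le (T := T) g hη
    obtain ⟨k, lam, hlam, hd⟩ := (hclose (min δ₁ δ₂) (lt_min hδ₁ hδ₂)).exists
    obtain ⟨a, ha⟩ := h₁ (μ k) lam hlam (hd.trans_le (min_le_left _ _))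
    obtain ⟨b, hb⟩ := h₂ (μ k) lam hlam (hd.trans_le (min_le_right _ _))
    have hT := (hμ k).toMeasurePreserving
    have := hlam.isProbabilityMeasure
    refine ⟨_, (RhoBar.isWeaklyMixing_iff hT).1 (hmix k) a b, fun n => ?_⟩
    -- Both correlations become correlations in L²(`lam`), relative to the same constant function 1,
    -- and can be compared there.
    rw [← RhoBar.corr_map hlam.liftSnd (hlam.koopman_liftSnd hT'),
      ← RhoBar.corr_map hlam.liftFst (hlam.koopman_liftFst hT)]
    have e₁ : hlam.liftFst (RhoBar.one (μ k)) = RhoBar.one lam :=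
      RhoBar.compMeasurePreserving_one hlam.measurePreserving_fst
    have e₂ : hlam.liftSnd (RhoBar.one μ') = RhoBar.one lam :=
      RhoBar.compMeasurePreserving_one hlam.measurePreserving_snd
    rw [e₁, e₂]
    refine (RhoBar.norm_corr_sub_corr_le (RhoBar.norm_koopman _) (RhoBar.norm_one lam)
      _ _ _ _ n).trans ?_
    have ha' : ‖hlam.liftFst a‖ ≤ ‖f‖ + 1 := by
      have := norm_sub_norm_le (hlam.liftFst a) (hlam.liftSnd f)
      rw [norm_sub_rev, hlam.liftSnd.norm_map] at this
      linarith
    rw [hlam.liftSnd.norm_map]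
    calc _ ≤ 2 * η * ‖g‖ + 2 * (‖f‖ + 1) * η := by gcongr
      _ ≤ ε := by linarith
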